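/- Let $a,q$ be complex numbers with $|q|<1$, put $(a;q)_\infty=\prod_{n\ge 0}(1-aq^n)$, and suppose that $(a;q)_\infty\neq 0$. Then the infinite products $(\pm a;q)_\infty$ converge, and the following continued fraction converges with $$\left(\frac{(-a;q)_\infty}{(a;q)_\infty}\right)^2=-1+\frac{2}{1-}\,\frac{2a}{1-q+}\,\frac{a^2(1+q)^2}{1-q^3+}\,\frac{a^2q(1+q^2)^2}{1-q^5+}\,\frac{a^2q^2(1+q^3)^2}{1-q^7+}\cdots .$$ Equivalently, $$\left(\frac{(-a;q)_\infty}{(a;q)_\infty}\right)^2=-1+\frac{2}{1-u(a,q)},$$ where $$u(a,q)=\frac{2a}{1-q+}\,\frac{a^2(1+q)^2}{1-q^3+}\,\frac{a^2q(1+q^2)^2}{1-q^5+}\,\frac{a^2q^2(1+q^3)^2}{1-q^7+}\cdots$$ is the case $b=-a$ of Ramanujan's continued fraction $$\frac{a-b}{1-q+}\,\frac{(a-bq)(aq-b)}{1-q^3+}\,\frac{q(a-bq^2)(aq^2-b)}{1-q^5+}\,\frac{q^2(a-bq^3)(aq^3-b)}{1-q^7+}\cdots .$$ In detail: if the left-hand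 side is not $-1$, then $u(a,q)$ converges to a finite value different from $1$ and the last identity holds; if the left-hand side equals $-1$, then the convergents of $u(a,q)$ tend to $\infty$ on the Riemann sphere, and the right-hand side is read as $-1$. -/

import Mathlib

open Filter Topology

noncomputable section

/-- The infinite `q`-shifted factorial `(a; q)_∞ = ∏_{n ≥ 0} (1 - a q ^ n)`. -/
def qPochInf (a q : ℂ) : ℂ := ∏' n : ℕ, (1 - a * q ^ n)

/-- The infinite continued fraction `b₀ + x 0 / (y 0 + x 1 / (y 1 + x 2 / (y 2 + ⋯)))`. -/
def cfrac (b₀ : ℂ) (x y : ℕ → ℂ) : GenContFract ℂ :=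
  ⟨b₀, Stream'.Seq.ofStream fun n => ⟨x n, y n⟩⟩

/-- The continued fraction `g` converges to the finite value `v`: with `Aₙ`, `Bₙ` its continuants,
all but finitely many of the convergents `Aₙ / Bₙ` are defined, and they tend to `v`. -/
def CFracHasValue (g : GenContFract ℂ) (v : ℂ) : Prop :=
  (∀ᶠ n in atTop, g.dens n ≠ 0) ∧ Tendsto (fun n => g.nums n / g.dens n) atTop (𝓝 v)

/-- The continued fraction `g` has the value `∞` on the Riemann sphere: the reciprocals
`Bₙ / Aₙ` of the convergents are eventually defined and tend to `0`. -/
def CFracHasValueInfty (g : GenContFract ℂ) : Prop :=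
  (∀ᶠ n in atTop, g.nums n ≠ 0) ∧ Tendsto (fun n => g.dens n / g.nums n) atTop (𝓝 0)

/-- Partial numerators of Ramanujan's continued fraction:
`a - b`, `(a - b q)(a q - b)`, `q (a - b q²)(a q² - b)`, `q² (a - b q³)(a q³ - b)`, … -/
def ramanujanNum (a b q : ℂ) : ℕ → ℂ
  | 0 => a - b
  | k + 1 => q ^ k * (a - b * q ^ (k + 1)) * (a * q ^ (k + 1) - b)

/-- Ramanujan's continued fraction
`(a - b)/(1 - q +) (a - b q)(a q - b)/(1 - q³ +) q (a - b q²)(a q² - b)/(1 - q⁵ +) ⋯`. -/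
def ramanujanCF (a b q : ℂ) : GenContFract ℂ :=
  cfrac 0 (ramanujanNum a b q) (fun k => 1 - q ^ (2 * k + 1))

/-- Partial numerators `2 a`, `a² (1 + q)²`, `a² q (1 + q²)²`, `a² q² (1 + q³)²`, … of `u(a, q)`. -/
def uNum (a q : ℂ) : ℕ → ℂ
  | 0 => 2 * a
  | k + 1 => a ^ 2 * q ^ k * (1 + q ^ (k + 1)) ^ 2

/-- The continued fraction
`u(a, q) = 2a/(1 - q +) a²(1 + q)²/(1 - q³ +) a² q (1 + q²)²/(1 - q⁵ +) ⋯`. -/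
def uCF (a q : ℂ) : GenContFract ℂ :=
  cfrac 0 (uNum a q) (fun k => 1 - q ^ (2 * k + 1))

/-- Partial numerators of `-1 + 2/(1 - u(a, q))`, written out as one continued fraction. -/
def fullNum (a q : ℂ) : ℕ → ℂ
  | 0 => 2
  | 1 => -(2 * a)
  | k + 2 => a ^ 2 * q ^ k * (1 + q ^ (k + 1)) ^ 2

/-- Partial denominators of `-1 + 2/(1 - u(a, q))`, written out as one continued fraction. -/
def fullDen (q : ℂ) : ℕ → ℂ
  | 0 => 1
  | k + 1 => 1 - q ^ (2 * k + 1)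

/-- The continued fraction
`-1 + 2/(1 -) 2a/(1 - q +) a²(1 + q)²/(1 - q³ +) a² q (1 + q²)²/(1 - q⁵ +) ⋯`. -/
def fullCF (a q : ℂ) : GenContFract ℂ := cfrac (-1) (fullNum a q) (fullDen q)

end

/-!
Let `Aₙ`, `Bₙ` be the continuants of Ramanujan's continued fraction with parameters `a`, `b`, and
put `Sₙ(a, b) = Aₙ + Bₙ`. Changing the signs of `a` and `b` changes the sign of `Aₙ` and fixes
`Bₙ`, so `Bₙ - Aₙ = Sₙ(-a, -b)` and everything is governed by the limit `S(a, b)` of `Sₙ(a, b)`.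
The limit exists because the three-term recurrence of `Sₙ` is a summable perturbation of
`Sₙ₊₂ = Sₙ₊₁`. A Bauer–Muir identity between the continuants at `(a q, b q)` and at `(a, b)` becomes
`S(a, b) = (1 + a) (1 - b) S(a q, b q)` in the limit, and iterating it gives
`S(a, b) = (-a; q)_∞ (b; q)_∞ S(0, 0)`, where `S(0, 0) = (q; q²)_∞ ≠ 0`.
-/

section PerturbedRecurrence

variable {E : Type*} [SeminormedAddCommGroup E] {u : ℕ → E} {c : ℕ → ℝ}

lemma max_norm_le_mul_exp_tsum (hc : ∀ n, 0 ≤ c n) (hs : Summable c)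
    (hu : ∀ n, ‖u (n + 2) - u (n + 1)‖ ≤ c n * max ‖u n‖ ‖u (n + 1)‖) (n : ℕ) :
    max ‖u n‖ ‖u (n + 1)‖ ≤ max ‖u 0‖ ‖u 1‖ * Real.exp (∑' k, c k) := by
  have hstep (k : ℕ) :
      max ‖u (k + 1)‖ ‖u (k + 2)‖ ≤ (1 + c k) * max ‖u k‖ ‖u (k + 1)‖ + 0 := by
    have hmax : 0 ≤ max ‖u k‖ ‖u (k + 1)‖ := (norm_nonneg _).trans (le_max_left _ _)
    have htri := norm_le_norm_add_norm_sub' (u (k + 2)) (u (k + 1))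
    have hle := le_max_right ‖u k‖ ‖u (k + 1)‖
    refine max_le ?_ ?_ <;> linarith [hu k, mul_nonneg (hc k) hmax]
  have hgronwall := discrete_gronwall (n₀ := 0) (u := fun k => max ‖u k‖ ‖u (k + 1)‖)
    (by positivity) (fun k _ => hstep k) (fun k _ => hc k) (fun _ _ => le_rfl) n.zero_le
  rw [Finset.sum_const_zero, add_zero] at hgronwall
  refine hgronwall.trans ?_
  gcongr
  exact hs.sum_le_tsum _ fun k _ => hc k

lemma dist_succ_le_of_perturbed_recurrence (hc : ∀ n, 0 ≤ c n) (hs : Summable c)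
    (hu : ∀ n, ‖u (n + 2) - u (n + 1)‖ ≤ c n * max ‖u n‖ ‖u (n + 1)‖) (n : ℕ) :
    dist (u (n + 1)) (u (n + 2)) ≤ c n * (max ‖u 0‖ ‖u 1‖ * Real.exp (∑' k, c k)) := by
  rw [dist_comm, dist_eq_norm]
  exact (hu n).trans (mul_le_mul_of_nonneg_left (max_norm_le_mul_exp_tsum hc hs hu n) (hc n))

end PerturbedRecurrence

lemma tendstoUniformly_of_dist_le_of_summable {ι α : Type*} [PseudoMetricSpace α]
    {F : ℕ → ι → α} {f : ι → α} {d : ℕ → ℝ} (hd : Summable d)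
    (hF : ∀ n i, dist (F n i) (F (n + 1) i) ≤ d n)
    (hf : ∀ i, Tendsto (fun n => F n i) atTop (𝓝 (f i))) : TendstoUniformly F f atTop := by
  rw [Metric.tendstoUniformly_iff]
  intro ε hε
  filter_upwards [(tendsto_sum_nat_add d).eventually_lt_const hε] with n hn i
  have htail := dist_le_tsum_of_dist_le_of_tendsto d (fun k => hF k i) hd (hf i) n
  simp only [add_comm n] at htail
  rw [dist_comm]
  exact htail.trans_lt hn

section QPochhammer

variable {q : ℂ}

lemma summable_norm_mul_pow (hq : ‖q‖ < 1) (a : ℂ) : Summable fun n : ℕ => ‖-(a * q ^ n)‖ := by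
  simpa using (summable_geometric_of_lt_one (norm_nonneg q) hq).mul_left ‖a‖

lemma multipliable_one_sub_mul_pow (hq : ‖q‖ < 1) (a : ℂ) :
    Multipliable fun n : ℕ => 1 - a * q ^ n := by
  simpa only [sub_eq_add_neg] using multipliable_one_add_of_summable (summable_norm_mul_pow hq a)

lemma tendsto_prod_qPochInf (hq : ‖q‖ < 1) (a : ℂ) :
    Tendsto (fun n => ∏ k ∈ Finset.range n, (1 - a * q ^ k)) atTop (𝓝 (qPochInf a q)) :=
  (multipliable_one_sub_mul_pow hq a).tendsto_prod_tprod_nat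

lemma qPochInf_ne_zero {a : ℂ} (hq : ‖q‖ < 1) (ha : ∀ n : ℕ, a * q ^ n ≠ 1) :
    qPochInf a q ≠ 0 := by
  simp only [qPochInf, sub_eq_add_neg]
  refine tprod_one_add_ne_zero_of_summable (fun n => ?_) (summable_norm_mul_pow hq a)
  rw [← sub_eq_add_neg]
  exact sub_ne_zero.mpr (ha n).symm

lemma qPochInf_self_sq_ne_zero (hq : ‖q‖ < 1) : qPochInf q (q ^ 2) ≠ 0 := by
  refine qPochInf_ne_zero (by simpa using pow_lt_one₀ (norm_nonneg q) hq two_ne_zero) fun n h => ?_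
  have hlt : ‖q ^ (2 * n + 1)‖ < 1 := by
    simpa using pow_lt_one₀ (norm_nonneg q) hq (2 * n).succ_ne_zero
  rw [pow_succ', pow_mul, h, norm_one] at hlt
  exact hlt.false

end QPochhammer

section Continuants

variable (b₀ : ℂ) (x y : ℕ → ℂ)

lemma cfrac_nums_zero : (cfrac b₀ x y).nums 0 = b₀ := rfl

lemma cfrac_nums_one : (cfrac b₀ x y).nums 1 = y 0 * b₀ + x 0 :=
  GenContFract.first_num_eq (g := cfrac b₀ x y) (gp := ⟨x 0, y 0⟩) rfl

lemma cfrac_dens_one : (cfrac b₀ x y).dens 1 = y 0 :=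
  GenContFract.first_den_eq (g := cfrac b₀ x y) (gp := ⟨x 0, y 0⟩) rfl

lemma cfrac_nums_add_two (n : ℕ) : (cfrac b₀ x y).nums (n + 2) =
    y (n + 1) * (cfrac b₀ x y).nums (n + 1) + x (n + 1) * (cfrac b₀ x y).nums n :=
  GenContFract.nums_recurrence (gp := ⟨x (n + 1), y (n + 1)⟩) rfl rfl rfl

lemma cfrac_dens_add_two (n : ℕ) : (cfrac b₀ x y).dens (n + 2) =
    y (n + 1) * (cfrac b₀ x y).dens (n + 1) + x (n + 1) * (cfrac b₀ x y).dens n :=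
  GenContFract.dens_recurrence (gp := ⟨x (n + 1), y (n + 1)⟩) rfl rfl rfl

/-- If `u` denotes the continued fraction `x 0 / (y 0 + x 1 / (y 1 + ⋯))`, this is the continued
fraction `-1 + 2 / (1 - u)`, written out in full. Its value is the Cayley transform
`(1 + u) / (1 - u)`. -/
noncomputable def cayleyCF : GenContFract ℂ :=
  cfrac (-1) (fun | 0 => 2 | 1 => -x 0 | k + 2 => x (k + 1)) (fun | 0 => 1 | k + 1 => y k)

lemma cayleyCF_nums_succ (n : ℕ) :
    (cayleyCF x y).nums (n + 1) = (cfrac 0 x y).nums n + (cfrac 0 x y).dens n := by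
  induction n using Nat.twoStepInduction with
  | zero =>
    rw [cayleyCF, cfrac_nums_one, cfrac_nums_zero, GenContFract.zeroth_den_eq_one]
    norm_num
  | one =>
    rw [cayleyCF, cfrac_nums_add_two, cfrac_nums_one, cfrac_nums_zero, cfrac_nums_one,
      cfrac_dens_one]
    ring
  | more n h₀ h₁ =>
    rw [cayleyCF] at *
    rw [cfrac_nums_add_two, h₀, h₁, cfrac_nums_add_two, cfrac_dens_add_two]
    ring

lemma cayleyCF_dens_succ (n : ℕ) :
    (cayleyCF x y).dens (n + 1) = (cfrac 0 x y).dens n - (cfrac 0 x y).nums n := by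
  induction n using Nat.twoStepInduction with
  | zero =>
    rw [cayleyCF, cfrac_dens_one, cfrac_nums_zero, GenContFract.zeroth_den_eq_one, sub_zero]
  | one =>
    rw [cayleyCF, cfrac_dens_add_two, cfrac_dens_one, GenContFract.zeroth_den_eq_one,
      cfrac_nums_one, cfrac_dens_one]
    ring
  | more n h₀ h₁ =>
    rw [cayleyCF] at *
    rw [cfrac_dens_add_two, h₀, h₁, cfrac_nums_add_two, cfrac_dens_add_two]
    ring

end Continuants

section Values

variable {g : GenContFract ℂ} {A B : ℂ}

lemma cfracHasValue_of_tendsto (hA : Tendsto g.nums atTop (𝓝 A)) (hB : Tendsto g.dens atTop (𝓝 B))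
    (hne : B ≠ 0) : CFracHasValue g (A / B) :=
  ⟨hB.eventually_ne hne, hA.div hB hne⟩

lemma cfracHasValueInfty_of_tendsto (hA : Tendsto g.nums atTop (𝓝 A))
    (hB : Tendsto g.dens atTop (𝓝 0)) (hne : A ≠ 0) : CFracHasValueInfty g :=
  ⟨hA.eventually_ne hne, zero_div A ▸ hB.div hA hne⟩

end Values

section RamanujanContinuants

variable (a b q : ℂ)

/-- The sum `Sₙ(a, b) = Aₙ + Bₙ` of the continuants of Ramanujan's continued fraction. Unlike `Aₙ`
and `Bₙ` themselves, it tends to an infinite product. -/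
noncomputable def contSum (n : ℕ) : ℂ := (ramanujanCF a b q).nums n + (ramanujanCF a b q).dens n

lemma contSum_zero : contSum a b q 0 = 1 := by
  rw [contSum, ramanujanCF, cfrac_nums_zero, GenContFract.zeroth_den_eq_one, zero_add]

lemma contSum_one : contSum a b q 1 = 1 - q + a - b := by
  rw [contSum, ramanujanCF, cfrac_nums_one, cfrac_dens_one, ramanujanNum]
  ring

lemma contSum_add_two (n : ℕ) :
    contSum a b q (n + 2) = (1 - q ^ (2 * n + 3)) * contSum a b q (n + 1)
      + q ^ n * (a - b * q ^ (n + 1)) * (a * q ^ (n + 1) - b) * contSum a b q n := by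
  rw [contSum, ramanujanCF, cfrac_nums_add_two, cfrac_dens_add_two, ← ramanujanCF, ramanujanNum,
    contSum, contSum]
  ring

lemma contSum_neg_neg (n : ℕ) :
    contSum (-a) (-b) q n = (ramanujanCF a b q).dens n - (ramanujanCF a b q).nums n := by
  induction n using Nat.twoStepInduction with
  | zero =>
    rw [contSum_zero, ramanujanCF, cfrac_nums_zero, GenContFract.zeroth_den_eq_one, sub_zero]
  | one =>
    rw [contSum_one, ramanujanCF, cfrac_nums_one, cfrac_dens_one, ramanujanNum]
    ring
  | more n h₀ h₁ =>
    rw [contSum_add_two, h₀, h₁, ramanujanCF, cfrac_nums_add_two, cfrac_dens_add_two, ramanujanNum]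
    ring

lemma ramanujanCF_nums_eq (n : ℕ) :
    (ramanujanCF a b q).nums n = (contSum a b q n - contSum (-a) (-b) q n) / 2 := by
  rw [contSum_neg_neg, contSum]
  ring

lemma ramanujanCF_dens_eq (n : ℕ) :
    (ramanujanCF a b q).dens n = (contSum a b q n + contSum (-a) (-b) q n) / 2 := by
  rw [contSum_neg_neg, contSum]
  ring

/-- Bauer–Muir: the right-hand side is the modified continuant
`Sₙ₊₂(a, b) + q ^ (n + 1) (q ^ (n + 2) - a b) Sₙ₊₁(a, b)`. -/
lemma contSum_bauerMuir (n : ℕ) :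
    (1 + a) * (1 - b) * contSum (a * q) (b * q) q (n + 1) =
      (1 - a * b * q ^ (n + 1)) * contSum a b q (n + 1)
        + q ^ n * (a - b * q ^ (n + 1)) * (a * q ^ (n + 1) - b) * contSum a b q n := by
  induction n using Nat.twoStepInduction with
  | zero => simp only [contSum_zero, contSum_one, zero_add]; ring
  | one => simp only [contSum_add_two _ _ _ 0, contSum_zero, contSum_one, zero_add]; ring
  | more n h₀ h₁ =>
    rw [contSum_add_two (a * q) (b * q) q (n + 1), contSum_add_two a b q (n + 1)]
    rw [contSum_add_two a b q n] at h₁ ⊢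
    linear_combination (1 - q ^ (2 * (n + 1) + 3)) * h₁
      + q ^ (n + 1) * (a * q - b * q * q ^ (n + 2)) * (a * q * q ^ (n + 2) - b * q) * h₀

lemma contSum_zero_zero (n : ℕ) :
    contSum 0 0 q n = ∏ k ∈ Finset.range n, (1 - q * (q ^ 2) ^ k) := by
  induction n using Nat.twoStepInduction with
  | zero => simp [contSum_zero]
  | one => simp [contSum_one]
  | more n _ h =>
    rw [contSum_add_two, h, Finset.prod_range_succ _ (n + 1)]
    ring

lemma continuous_contSum (n : ℕ) : Continuous fun p : ℂ × ℂ => contSum p.1 p.2 q n := by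
  induction n using Nat.twoStepInduction with
  | zero => simp only [contSum_zero]; fun_prop
  | one => simp only [contSum_one]; fun_prop
  | more n h₀ h₁ => simp only [contSum_add_two]; fun_prop

end RamanujanContinuants

section Limit

variable {q : ℂ}

lemma norm_contSum_sub_le (hq : ‖q‖ < 1) {a b : ℂ} {R : ℝ} (hR : ‖a‖ + ‖b‖ ≤ R) (n : ℕ) :
    ‖contSum a b q (n + 2) - contSum a b q (n + 1)‖ ≤
      (1 + R ^ 2) * ‖q‖ ^ n * max ‖contSum a b q n‖ ‖contSum a b q (n + 1)‖ := by
  have hpow : ‖q ^ (n + 1)‖ ≤ 1 := by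
    simpa using pow_le_one₀ (n := n + 1) (norm_nonneg q) hq.le
  have hleft : ‖a - b * q ^ (n + 1)‖ ≤ R :=
    calc ‖a - b * q ^ (n + 1)‖ ≤ ‖a‖ + ‖b‖ * ‖q ^ (n + 1)‖ := by
          simpa only [norm_mul] using norm_sub_le a (b * q ^ (n + 1))
      _ ≤ ‖a‖ + ‖b‖ * 1 := by gcongr
      _ ≤ R := by rwa [mul_one]
  have hright : ‖a * q ^ (n + 1) - b‖ ≤ R :=
    calc ‖a * q ^ (n + 1) - b‖ ≤ ‖a‖ * ‖q ^ (n + 1)‖ + ‖b‖ := by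
          simpa only [norm_mul] using norm_sub_le (a * q ^ (n + 1)) b
      _ ≤ ‖a‖ * 1 + ‖b‖ := by gcongr
      _ ≤ R := by rwa [mul_one]
  have hden : ‖q‖ ^ (2 * n + 3) ≤ ‖q‖ ^ n :=
    pow_le_pow_of_le_one (norm_nonneg q) hq.le (by omega)
  set M := max ‖contSum a b q n‖ ‖contSum a b q (n + 1)‖
  calc ‖contSum a b q (n + 2) - contSum a b q (n + 1)‖
      = ‖q ^ n * (a - b * q ^ (n + 1)) * (a * q ^ (n + 1) - b) * contSum a b q n
          - q ^ (2 * n + 3) * contSum a b q (n + 1)‖ := by rw [contSum_add_two]; ring_nf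
    _ ≤ ‖q‖ ^ n * ‖a - b * q ^ (n + 1)‖ * ‖a * q ^ (n + 1) - b‖ * ‖contSum a b q n‖
          + ‖q‖ ^ (2 * n + 3) * ‖contSum a b q (n + 1)‖ := by
        simpa only [norm_mul, norm_pow] using norm_sub_le
          (q ^ n * (a - b * q ^ (n + 1)) * (a * q ^ (n + 1) - b) * contSum a b q n)
          (q ^ (2 * n + 3) * contSum a b q (n + 1))
    _ ≤ ‖q‖ ^ n * R * R * M + ‖q‖ ^ n * M := by
        have hR₀ : 0 ≤ R := (norm_nonneg _).trans hleft
        gcongr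
        · exact le_max_left _ _
        · exact le_max_right _ _
    _ = (1 + R ^ 2) * ‖q‖ ^ n * M := by ring

lemma exists_summable_dist_contSum_le (hq : ‖q‖ < 1) (R : ℝ) :
    ∃ d : ℕ → ℝ, Summable d ∧ ∀ a b : ℂ, ‖a‖ + ‖b‖ ≤ R → ∀ n,
      dist (contSum a b q (n + 1)) (contSum a b q (n + 2)) ≤ d n := by
  set c : ℕ → ℝ := fun n => (1 + R ^ 2) * ‖q‖ ^ n
  have hc (n : ℕ) : 0 ≤ c n := by positivity
  have hs : Summable c := (summable_geometric_of_lt_one (norm_nonneg q) hq).mul_left _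
  refine ⟨fun n => c n * ((2 + R) * Real.exp (∑' k, c k)), hs.mul_right _, fun a b hR n => ?_⟩
  have hinit : max ‖contSum a b q 0‖ ‖contSum a b q 1‖ ≤ 2 + R := by
    have hR₀ : 0 ≤ R := (by positivity : 0 ≤ ‖a‖ + ‖b‖).trans hR
    rw [contSum_zero, contSum_one, norm_one]
    have h₁ := norm_sub_le (1 - q + a) b
    have h₂ := norm_add_le (1 - q) a
    have h₃ := norm_sub_le 1 q
    rw [norm_one] at h₃
    exact max_le (by linarith) (by linarith)
  exact (dist_succ_le_of_perturbed_recurrence hc hs (norm_contSum_sub_le hq hR) n).trans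
    (mul_le_mul_of_nonneg_left (mul_le_mul_of_nonneg_right hinit (Real.exp_nonneg _)) (hc n))

/-- The limit `S(a, b)` of `Sₙ(a, b)`. It exists for `‖q‖ < 1`, see `tendsto_contLim`. -/
noncomputable def contLim (a b q : ℂ) : ℂ := limUnder atTop (contSum a b q)

lemma tendsto_contLim (hq : ‖q‖ < 1) (a b : ℂ) :
    Tendsto (contSum a b q) atTop (𝓝 (contLim a b q)) := by
  obtain ⟨d, hd, hdist⟩ := exists_summable_dist_contSum_le hq (‖a‖ + ‖b‖)
  have hcauchy : CauchySeq fun n => contSum a b q (n + 1) :=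
    cauchySeq_of_dist_le_of_summable d (hdist a b le_rfl) hd
  obtain ⟨L, hL⟩ := cauchySeq_tendsto_of_complete hcauchy
  exact tendsto_nhds_limUnder ⟨L, (tendsto_add_atTop_iff_nat 1).mp hL⟩

lemma contLim_eq_mul_contLim (hq : ‖q‖ < 1) (a b : ℂ) :
    contLim a b q = (1 + a) * (1 - b) * contLim (a * q) (b * q) q := by
  have hpow := tendsto_pow_atTop_nhds_zero_of_norm_lt_one hq
  have hpow' := (tendsto_add_atTop_iff_nat 1).mpr hpow
  have hS := tendsto_contLim hq a b
  have hS' := (tendsto_add_atTop_iff_nat 1).mpr hS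
  have hleft := ((tendsto_add_atTop_iff_nat 1).mpr
    (tendsto_contLim hq (a * q) (b * q))).const_mul ((1 + a) * (1 - b))
  have hright := (((hpow'.const_mul (a * b)).const_sub 1).mul hS').add
    (((hpow.mul ((hpow'.const_mul b).const_sub a)).mul ((hpow'.const_mul a).sub_const b)).mul hS)
  rw [tendsto_nhds_unique (hleft.congr (contSum_bauerMuir a b q)) hright]
  ring

lemma contLim_eq_prod_mul_contLim (hq : ‖q‖ < 1) (a b : ℂ) (m : ℕ) :
    contLim a b q = (∏ k ∈ Finset.range m, (1 - -a * q ^ k)) *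
      (∏ k ∈ Finset.range m, (1 - b * q ^ k)) * contLim (a * q ^ m) (b * q ^ m) q := by
  induction m with
  | zero => simp
  | succ m ih =>
    rw [ih, contLim_eq_mul_contLim hq (a * q ^ m), Finset.prod_range_succ, Finset.prod_range_succ,
      pow_succ q m, ← mul_assoc a, ← mul_assoc b]
    ring

lemma tendsto_contLim_mul_pow (hq : ‖q‖ < 1) (a b : ℂ) :
    Tendsto (fun m : ℕ => contLim (a * q ^ m) (b * q ^ m) q) atTop (𝓝 (contLim 0 0 q)) := by
  obtain ⟨d, hd, hdist⟩ := exists_summable_dist_contSum_le hq (‖a‖ + ‖b‖)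
  have hpow := tendsto_pow_atTop_nhds_zero_of_norm_lt_one hq
  have hnorm (m : ℕ) : ‖a * q ^ m‖ + ‖b * q ^ m‖ ≤ ‖a‖ + ‖b‖ := by
    have hm : ‖q‖ ^ m ≤ 1 := pow_le_one₀ (norm_nonneg q) hq.le
    rw [norm_mul, norm_mul, norm_pow]
    exact add_le_add (mul_le_of_le_one_right (norm_nonneg a) hm)
      (mul_le_of_le_one_right (norm_nonneg b) hm)
  have hunif : TendstoUniformly (fun n m => contSum (a * q ^ m) (b * q ^ m) q (n + 1))
      (fun m => contLim (a * q ^ m) (b * q ^ m) q) atTop :=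
    tendstoUniformly_of_dist_le_of_summable hd (fun n m => hdist _ _ (hnorm m) n)
      fun m => (tendsto_add_atTop_iff_nat 1).mpr (tendsto_contLim hq (a * q ^ m) (b * q ^ m))
  have hzero : Tendsto (fun m : ℕ => (a * q ^ m, b * q ^ m)) atTop (𝓝 (0, 0)) := by
    simpa using (hpow.const_mul a).prodMk_nhds (hpow.const_mul b)
  have hcont (n : ℕ) : Tendsto (fun m : ℕ => contSum (a * q ^ m) (b * q ^ m) q (n + 1)) atTop
      (𝓝 (contSum 0 0 q (n + 1))) := by
    simpa only [Function.comp_def] using ((continuous_contSum q (n + 1)).tendsto (0, 0)).comp hzero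
  have hlim := (tendsto_add_atTop_iff_nat 1).mpr (tendsto_contLim hq 0 0)
  exact hunif.tendsto_of_eventually_tendsto (Eventually.of_forall hcont) hlim

lemma contLim_zero_zero (hq : ‖q‖ < 1) : contLim 0 0 q = qPochInf q (q ^ 2) := by
  have hq2 : ‖q ^ 2‖ < 1 := by simpa using pow_lt_one₀ (norm_nonneg q) hq two_ne_zero
  exact tendsto_nhds_unique (tendsto_contLim hq 0 0)
    ((tendsto_prod_qPochInf hq2 q).congr fun n => (contSum_zero_zero q n).symm)

lemma contLim_eq_qPochInf_mul (hq : ‖q‖ < 1) (a b : ℂ) :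
    contLim a b q = qPochInf (-a) q * qPochInf b q * qPochInf q (q ^ 2) := by
  have hlim := ((tendsto_prod_qPochInf hq (-a)).mul (tendsto_prod_qPochInf hq b)).mul
    (tendsto_contLim_mul_pow hq a b)
  rw [← contLim_zero_zero hq]
  exact tendsto_nhds_unique
    (tendsto_const_nhds.congr (contLim_eq_prod_mul_contLim hq a b)) hlim

lemma tendsto_contSum (hq : ‖q‖ < 1) (a b : ℂ) : Tendsto (contSum a b q) atTop
    (𝓝 (qPochInf (-a) q * qPochInf b q * qPochInf q (q ^ 2))) :=
  contLim_eq_qPochInf_mul hq a b ▸ tendsto_contLim hq a b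

end Limit

section RamanujanValues

variable {q : ℂ}

lemma tendsto_ramanujanCF_nums (hq : ‖q‖ < 1) (a b : ℂ) :
    Tendsto (ramanujanCF a b q).nums atTop
      (𝓝 ((qPochInf (-a) q * qPochInf b q - qPochInf a q * qPochInf (-b) q)
        * (qPochInf q (q ^ 2) / 2))) := by
  have h := ((tendsto_contSum hq a b).sub (tendsto_contSum hq (-a) (-b))).div_const 2
  rw [neg_neg, ← sub_mul, mul_div_assoc] at h
  exact h.congr fun n => (ramanujanCF_nums_eq a b q n).symm

lemma tendsto_ramanujanCF_dens (hq : ‖q‖ < 1) (a b : ℂ) :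
    Tendsto (ramanujanCF a b q).dens atTop
      (𝓝 ((qPochInf (-a) q * qPochInf b q + qPochInf a q * qPochInf (-b) q)
        * (qPochInf q (q ^ 2) / 2))) := by
  have h := ((tendsto_contSum hq a b).add (tendsto_contSum hq (-a) (-b))).div_const 2
  rw [neg_neg, ← add_mul, mul_div_assoc] at h
  exact h.congr fun n => (ramanujanCF_dens_eq a b q n).symm

lemma cfracHasValue_ramanujanCF {a b : ℂ} (hq : ‖q‖ < 1)
    (h : qPochInf (-a) q * qPochInf b q + qPochInf a q * qPochInf (-b) q ≠ 0) :
    CFracHasValue (ramanujanCF a b q)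
      ((qPochInf (-a) q * qPochInf b q - qPochInf a q * qPochInf (-b) q) /
        (qPochInf (-a) q * qPochInf b q + qPochInf a q * qPochInf (-b) q)) := by
  have hL : qPochInf q (q ^ 2) / 2 ≠ 0 := div_ne_zero (qPochInf_self_sq_ne_zero hq) two_ne_zero
  rw [← mul_div_mul_right _ _ hL]
  exact cfracHasValue_of_tendsto (tendsto_ramanujanCF_nums hq a b)
    (tendsto_ramanujanCF_dens hq a b) (mul_ne_zero h hL)

lemma cfracHasValueInfty_ramanujanCF {a b : ℂ} (hq : ‖q‖ < 1)
    (hadd : qPochInf (-a) q * qPochInf b q + qPochInf a q * qPochInf (-b) q = 0)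
    (hsub : qPochInf (-a) q * qPochInf b q - qPochInf a q * qPochInf (-b) q ≠ 0) :
    CFracHasValueInfty (ramanujanCF a b q) := by
  have hL : qPochInf q (q ^ 2) / 2 ≠ 0 := div_ne_zero (qPochInf_self_sq_ne_zero hq) two_ne_zero
  have hdens := tendsto_ramanujanCF_dens hq a b
  rw [hadd, zero_mul] at hdens
  exact cfracHasValueInfty_of_tendsto (tendsto_ramanujanCF_nums hq a b) hdens (mul_ne_zero hsub hL)

lemma cfracHasValue_cayleyCF_ramanujanNum {a b : ℂ} (hq : ‖q‖ < 1)
    (h : qPochInf a q * qPochInf (-b) q ≠ 0) :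
    CFracHasValue (cayleyCF (ramanujanNum a b q) fun k => 1 - q ^ (2 * k + 1))
      (qPochInf (-a) q * qPochInf b q / (qPochInf a q * qPochInf (-b) q)) := by
  have hL := qPochInf_self_sq_ne_zero hq
  have hdens := tendsto_contSum hq (-a) (-b)
  rw [neg_neg] at hdens
  rw [← mul_div_mul_right _ _ hL]
  refine cfracHasValue_of_tendsto ?_ ?_ (mul_ne_zero h hL)
  · refine (tendsto_add_atTop_iff_nat 1).mp ((tendsto_contSum hq a b).congr fun n => ?_)
    rw [cayleyCF_nums_succ, contSum, ramanujanCF]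
  · refine (tendsto_add_atTop_iff_nat 1).mp (hdens.congr fun n => ?_)
    rw [cayleyCF_dens_succ, contSum_neg_neg, ramanujanCF]

end RamanujanValues

lemma uCF_eq_ramanujanCF (a q : ℂ) : uCF a q = ramanujanCF a (-a) q := by
  have hnum : uNum a q = ramanujanNum a (-a) q := by
    funext n
    cases n <;> simp only [ramanujanNum, uNum] <;> ring
  rw [uCF, ramanujanCF, hnum]

lemma fullCF_eq_cayleyCF (a q : ℂ) :
    fullCF a q = cayleyCF (ramanujanNum a (-a) q) fun k => 1 - q ^ (2 * k + 1) := by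
  rw [fullCF, cayleyCF]
  congr 1
  funext n
  rcases n with _ | _ | n <;> simp only [fullNum, ramanujanNum] <;> ring

theorem proposition6_general (a b q : ℂ) (hq : ‖q‖ < 1)
    (hab : qPochInf a q * qPochInf (-b) q ≠ 0) :
    (∀ c : ℂ, Multipliable fun n : ℕ => 1 - c * q ^ n) ∧
    CFracHasValue (cayleyCF (ramanujanNum a b q) fun k => 1 - q ^ (2 * k + 1))
      (qPochInf (-a) q * qPochInf b q / (qPochInf a q * qPochInf (-b) q)) ∧
    (qPochInf (-a) q * qPochInf b q / (qPochInf a q * qPochInf (-b) q) ≠ -1 →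
      ∃ u : ℂ, CFracHasValue (ramanujanCF a b q) u ∧ u ≠ 1 ∧
        qPochInf (-a) q * qPochInf b q / (qPochInf a q * qPochInf (-b) q) = -1 + 2 / (1 - u)) ∧
    (qPochInf (-a) q * qPochInf b q / (qPochInf a q * qPochInf (-b) q) = -1 →
      CFracHasValueInfty (ramanujanCF a b q)) := by
  refine ⟨multipliable_one_sub_mul_pow hq, cfracHasValue_cayleyCF_ramanujanNum hq hab,
    fun hne => ?_, fun heq => ?_⟩
  · have hadd : qPochInf (-a) q * qPochInf b q + qPochInf a q * qPochInf (-b) q ≠ 0 := by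
      rwa [Ne, div_eq_iff hab, neg_one_mul, eq_neg_iff_add_eq_zero] at hne
    have hvalue := cfracHasValue_ramanujanCF hq hadd
    generalize qPochInf (-a) q * qPochInf b q = X at *
    generalize qPochInf a q * qPochInf (-b) q = Y at *
    have hu : 1 - (X - Y) / (X + Y) = 2 * Y / (X + Y) := by
      rw [one_sub_div hadd]
      ring
    refine ⟨_, hvalue, fun h => ?_, ?_⟩
    · rw [h, sub_self] at hu
      exact div_ne_zero (mul_ne_zero two_ne_zero hab) hadd hu.symm
    · rw [hu]
      field_simp
      ring
  · rw [div_eq_iff hab, neg_one_mul] at heq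
    refine cfracHasValueInfty_ramanujanCF hq (by rw [heq, neg_add_cancel]) ?_
    rw [heq, ← neg_add', neg_ne_zero, ← two_mul]
    exact mul_ne_zero two_ne_zero hab

theorem proposition6 (a q : ℂ) (hq : ‖q‖ < 1) (ha : qPochInf a q ≠ 0) :
    -- both infinite products converge
    Multipliable (fun n : ℕ => 1 - a * q ^ n) ∧
    Multipliable (fun n : ℕ => 1 - (-a) * q ^ n) ∧
    -- `u(a, q)` is the specialization `b = -a` of Ramanujan's continued fraction
    uCF a q = ramanujanCF a (-a) q ∧
    -- the continued fraction `-1 + 2/(1 -) 2a/(1 - q +) ⋯` converges to the squared quotient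
    CFracHasValue (fullCF a q) ((qPochInf (-a) q / qPochInf a q) ^ 2) ∧
    -- if the squared quotient is not `-1`, then `u(a, q)` has a finite value `u ≠ 1`
    ((qPochInf (-a) q / qPochInf a q) ^ 2 ≠ -1 →
      ∃ u : ℂ, CFracHasValue (uCF a q) u ∧ u ≠ 1 ∧
        (qPochInf (-a) q / qPochInf a q) ^ 2 = -1 + 2 / (1 - u)) ∧
    -- if it is `-1`, then `u(a, q) = ∞`, so that `-1 + 2 / (1 - u) = -1` in the usual sense
    ((qPochInf (-a) q / qPochInf a q) ^ 2 = -1 → CFracHasValueInfty (uCF a q)) := by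
  obtain ⟨hmul, h⟩ := proposition6_general a (-a) q hq (by rwa [neg_neg, mul_self_ne_zero])
  simp only [neg_neg, ← sq, ← div_pow, ← fullCF_eq_cayleyCF, ← uCF_eq_ramanujanCF] at h
  exact ⟨hmul a, hmul (-a), uCF_eq_ramanujanCF a q, h⟩
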